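/- A subtree of a finite tree $T$ is a nonempty induced subgraph of $T$ that is connected (and thus again a tree). The mean subtree order $\mu_T$ of $T$ is the average number of vertices of its subtrees. A tree on $n$ vertices is called optimal if its mean subtree order is the greatest among all trees on $n$ vertices. A double-broom is a tree that consists of a path with at least one vertex, with at least one leaf attached at each of its two ends (the numbers of leaves at the two ends need not be equal; if the path has a single vertex, all leaves are attached to it). Then for all sufficiently large $n$, no double-broom on $n$ vertices is optimal: there is an $N$ such that for every $n \ge N$ and every double-broom $T$ on $n$ vertices, there is a tree $T'$ on $n$ vertices with $\mu_{T'} > \mu_T$. -/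

import Mathlib

namespace MeanSubtree

open Classical in
/-- The vertex sets of the subtrees of `G`: the (nonempty) vertex sets whose induced subgraph
is connected. When `G` is a tree, these induced subgraphs are trees. -/
noncomputable def subtrees {V : Type*} [Fintype V] (G : SimpleGraph V) : Finset (Finset V) :=
  Finset.univ.filter fun S => (G.induce (S : Set V)).Connected

/-- The mean subtree order: the average number of vertices of a subtree. -/
noncomputable def meanSubtreeOrder {V : Type*} [Fintype V] (G : SimpleGraph V) : ℚ :=
  (∑ S ∈ subtrees G, (S.card : ℚ)) / (subtrees G).card

/-- `T` is an optimal tree: it has the greatest mean subtree order among all trees of the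
same order. -/
def IsOptimal {V : Type*} [Fintype V] (T : SimpleGraph V) : Prop :=
  T.IsTree ∧ ∀ T' : SimpleGraph V, T'.IsTree → meanSubtreeOrder T' ≤ meanSubtreeOrder T

/-- The graph consisting of a path on the `p` vertices `0, …, p - 1`, of `a` vertices joined
only to the first vertex of the path, and of `b` vertices joined only to its last vertex. -/
def doubleBroom (p a b : ℕ) : SimpleGraph (Fin p ⊕ Fin a ⊕ Fin b) :=
  SimpleGraph.fromRel fun x y =>
    match x, y with
    | .inl i, .inl j => (i : ℕ) + 1 = j
    | .inl i, .inr (.inl _) => (i : ℕ) = 0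
    | .inl i, .inr (.inr _) => (i : ℕ) + 1 = p
    | _, _ => False

/-- `G` is a double-broom: a nonempty path with at least one leaf attached at each end
(the two numbers of leaves may differ). -/
def IsDoubleBroom {V : Type*} (G : SimpleGraph V) : Prop :=
  ∃ p a b : ℕ, 1 ≤ p ∧ 1 ≤ a ∧ 1 ≤ b ∧ Nonempty (G ≃g doubleBroom p a b)

end MeanSubtree

namespace MeanSubtree

/-! Compare trees of the same order through the excess at a fixed `t`: it vanishes at a tree's own
mean, and another tree has larger mean than `t` exactly when its excess at `t` is positive. In a
caterpillar, a subtree is a single leaf or an interval of the path with any subset of the leaves on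
it, so excesses become explicit sums.

Suppose a double-broom with path order `p` and `a ≥ b` leaves is optimal, with mean `t`. A balanced
broom with about `n / 40` leaves at each end forces `t ≥ 19n/20` (`IsOptimal.le_meanSubtreeOrder`).
Since `t ≤ n - (a + b) / 2`, it follows that `a + b ≤ n / 10`. If `2 ^ b < 2 * p`, the subtrees
containing one end but not the other pull the mean too low (`excess_doubleBroom_le`), so `2 ^ b ≥ 2
* p`. Now move one leaf from the end with `a` leaves to the next path vertex. This halves the number
of small subtrees that meet the path only in that end, and for such `a`, `b` the gain outweighs
every loss (`excess_movedBroom_sub`), a contradiction. -/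

/-! ### Excess and mean subtree order -/

/-- The sum over all subtrees of the difference between their order and `t`. -/
noncomputable def excess {V : Type*} [Fintype V] (G : SimpleGraph V) (t : ℚ) : ℚ :=
  ∑ S ∈ subtrees G, ((S.card : ℚ) - t)

lemma mem_subtrees {V : Type*} [Fintype V] {G : SimpleGraph V} {S : Finset V} :
    S ∈ subtrees G ↔ (G.induce (S : Set V)).Connected := by
  simp [subtrees]

lemma singleton_mem_subtrees {V : Type*} [Fintype V] (G : SimpleGraph V) (v : V) :
    {v} ∈ subtrees G := by
  rw [mem_subtrees, Finset.coe_singleton]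
  have : Nonempty ({v} : Set V) := ⟨⟨v, rfl⟩⟩
  exact ⟨SimpleGraph.Preconnected.of_subsingleton⟩

lemma excess_eq {V : Type*} [Fintype V] (G : SimpleGraph V) (t : ℚ) :
    excess G t = (∑ S ∈ subtrees G, (S.card : ℚ)) - (subtrees G).card * t := by
  simp [excess, Finset.sum_sub_distrib]

lemma card_subtrees_pos {V : Type*} [Fintype V] [Nonempty V] (G : SimpleGraph V) :
    (0 : ℚ) < (subtrees G).card := by
  obtain ⟨v⟩ := ‹Nonempty V›
  exact_mod_cast Finset.card_pos.2 ⟨_, singleton_mem_subtrees G v⟩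

lemma excess_meanSubtreeOrder {V : Type*} [Fintype V] [Nonempty V] (G : SimpleGraph V) :
    excess G (meanSubtreeOrder G) = 0 := by
  have := card_subtrees_pos G
  rw [excess_eq, meanSubtreeOrder]
  field_simp
  ring

lemma excess_nonpos_iff {V : Type*} [Fintype V] [Nonempty V] (G : SimpleGraph V) (t : ℚ) :
    excess G t ≤ 0 ↔ meanSubtreeOrder G ≤ t := by
  have := card_subtrees_pos G
  rw [excess_eq, meanSubtreeOrder, div_le_iff₀ this, sub_nonpos, mul_comm]

lemma excess_antitone {V : Type*} [Fintype V] (G : SimpleGraph V) : Antitone (excess G) :=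
  fun _ _ h => Finset.sum_le_sum fun _ _ => sub_le_sub_left h _

lemma map_mem_subtrees {V W : Type*} [Fintype V] [Fintype W] {G : SimpleGraph V}
    {H : SimpleGraph W} (e : G ≃g H) {S : Finset V} :
    S.map e.toEquiv.toEmbedding ∈ subtrees H ↔ S ∈ subtrees G := by
  rw [mem_subtrees, mem_subtrees]
  let e' : G.induce (S : Set V) ≃g H.induce (S.map e.toEquiv.toEmbedding : Set W) :=
    { toEquiv := e.toEquiv.subtypeEquiv (by intro v; simp)
      map_rel_iff' := by
        intro x y
        exact e.map_rel_iff }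
  exact e'.connected_iff.symm

lemma excess_congr {V W : Type*} [Fintype V] [Fintype W] {G : SimpleGraph V}
    {H : SimpleGraph W} (e : G ≃g H) (t : ℚ) : excess G t = excess H t := by
  refine Finset.sum_bij (fun S _ => S.map e.toEquiv.toEmbedding)
    (fun S hS => (map_mem_subtrees e).2 hS) (fun S _ S' _ h => Finset.map_injective _ h)
    (fun S hS => ?_) (fun S _ => by simp)
  have key : (S.map e.symm.toEquiv.toEmbedding).map e.toEquiv.toEmbedding = S := by
    ext x
    rw [Finset.mem_map_equiv, Finset.mem_map_equiv]
    exact iff_of_eq (congrArg (· ∈ S) (e.apply_symm_apply x))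
  exact ⟨S.map e.symm.toEquiv.toEmbedding, (map_mem_subtrees e).1 (by rwa [key]), key⟩

/-- An optimal tree has at least the mean subtree order of any tree of the same order, whatever
its vertex type. -/
lemma IsOptimal.excess_nonpos {V W : Type*} [Fintype V] [Fintype W] [Nonempty V]
    {T : SimpleGraph V} (hT : IsOptimal T) {H : SimpleGraph W} (hH : H.IsTree)
    (hc : Fintype.card W = Fintype.card V) : excess H (meanSubtreeOrder T) ≤ 0 := by
  let e : V ≃ W := Fintype.equivOfCardEq hc.symm
  have e' : H.comap e ≃g H := SimpleGraph.Iso.comap e H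
  rw [← excess_congr e', excess_nonpos_iff]
  exact hT.2 _ (e'.isTree_iff.2 hH)

/-! ### Subtrees of caterpillars -/

/-- The caterpillar that consists of a path on `0, …, p - 1` and, for each `l`, a leaf
attached to the vertex `f l` of the path. -/
def caterpillar (p : ℕ) {L : Type*} (f : L → ℕ) : SimpleGraph (Fin p ⊕ L) :=
  SimpleGraph.fromRel fun x y =>
    match x, y with
    | .inl i, .inl j => (i : ℕ) + 1 = j
    | .inl i, .inr l => f l = i
    | _, _ => False

section caterpillar

variable {p : ℕ} {L : Type*} {f : L → ℕ}

@[simp] lemma caterpillar_adj_inl_inl {i j : Fin p} :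
    (caterpillar p f).Adj (.inl i) (.inl j) ↔ (i : ℕ) + 1 = j ∨ (j : ℕ) + 1 = i := by
  simp only [caterpillar, SimpleGraph.fromRel_adj, ne_eq, Sum.inl.injEq, Fin.ext_iff]
  omega

@[simp] lemma caterpillar_adj_inl_inr {i : Fin p} {l : L} :
    (caterpillar p f).Adj (.inl i) (.inr l) ↔ f l = i := by
  simp [caterpillar]

@[simp] lemma caterpillar_adj_inr_inl {i : Fin p} {l : L} :
    (caterpillar p f).Adj (.inr l) (.inl i) ↔ f l = i := by
  simp [caterpillar]

@[simp] lemma caterpillar_adj_inr_inr {l l' : L} :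
    ¬ (caterpillar p f).Adj (.inr l) (.inr l') := by
  simp [caterpillar]

lemma mem_of_induce_preconnected {V : Type*} {G : SimpleGraph V} {S : Set V}
    (h : (G.induce S).Preconnected) {Q : V → Prop}
    (hQ : ∀ x ∈ S, ∀ y ∈ S, G.Adj x y → Q x → Q y) {x y : V} (hx : x ∈ S) (hy : y ∈ S)
    (hQx : Q x) : Q y := by
  obtain ⟨w⟩ := h ⟨x, hx⟩ ⟨y, hy⟩
  have : ∀ (u v : S) (_ : (G.induce S).Walk u v), Q u → Q v := by
    intro u v w
    induction w with
    | nil => exact id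
    | cons hadj _ ih => exact fun hu => ih (hQ _ (Subtype.prop _) _ (Subtype.prop _) hadj hu)
  exact this _ _ w hQx

variable [Fintype L]

/-- The leaves of a caterpillar that are attached to the vertices `i, …, j` of the path. -/
def leavesBetween (f : L → ℕ) (i j : ℕ) : Finset L := {l | i ≤ f l ∧ f l ≤ j}

lemma interval_mem_subtrees {i j : Fin p} (hij : i ≤ j) {U : Finset L}
    (hU : U ⊆ leavesBetween f i j) :
    (Finset.Icc i j).disjSum U ∈ subtrees (caterpillar p f) := by
  rw [mem_subtrees]
  set S : Set (Fin p ⊕ L) := ↑((Finset.Icc i j).disjSum U) with hS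
  have hmem : ∀ k : Fin p, Sum.inl k ∈ S ↔ i ≤ k ∧ k ≤ j := by intro k; simp [hS]
  have hi : Sum.inl i ∈ S := (hmem i).2 ⟨le_rfl, hij⟩
  have hpath : ∀ (d : ℕ) (k : Fin p) (hk : Sum.inl k ∈ S), (k : ℕ) = i + d →
      ((caterpillar p f).induce S).Reachable ⟨_, hi⟩ ⟨_, hk⟩ := by
    intro d
    induction d with
    | zero =>
      intro k hk h
      obtain rfl : k = i := Fin.ext (by omega)
      rfl
    | succ d ih =>
      intro k hk h
      have hkj := ((hmem k).1 hk).2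
      rw [Fin.le_def] at hkj
      have hk' : Sum.inl (⟨i + d, by omega⟩ : Fin p) ∈ S :=
        (hmem _).2 ⟨by simp [Fin.le_def], by rw [Fin.le_def]; simp only; omega⟩
      refine (ih _ hk' rfl).trans (SimpleGraph.Adj.reachable ?_)
      simp only [SimpleGraph.comap_adj, Function.Embedding.subtype_apply, caterpillar_adj_inl_inl]
      omega
  rw [SimpleGraph.connected_iff_exists_forall_reachable]
  refine ⟨⟨_, hi⟩, ?_⟩
  rintro ⟨k | l, hx⟩
  · have := ((hmem k).1 hx).1
    rw [Fin.le_def] at this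
    exact hpath (k - i) k hx (by omega)
  · have hl := hU (by simpa [hS] using hx : l ∈ U)
    simp only [leavesBetween, Finset.mem_filter, Finset.mem_univ, true_and] at hl
    have hk : Sum.inl (⟨f l, by omega⟩ : Fin p) ∈ S := (hmem _).2 ⟨hl.1, hl.2⟩
    refine (hpath (f l - i) _ hk (by simp only; omega)).trans (SimpleGraph.Adj.reachable ?_)
    simp

lemma eq_of_mem_subtrees (hf : ∀ l, f l < p) {S : Finset (Fin p ⊕ L)}
    (hS : S ∈ subtrees (caterpillar p f)) :
    (∃ l, S = {.inr l}) ∨ ∃ i j : Fin p, i ≤ j ∧ ∃ U ⊆ leavesBetween f i j,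
      S = (Finset.Icc i j).disjSum U := by
  rw [mem_subtrees] at hS
  -- A leaf whose only neighbour is missing cannot be joined to anything else in `S`.
  by_cases h : ∃ l, .inr l ∈ S ∧ .inl ⟨f l, hf l⟩ ∉ S
  · obtain ⟨l, hl, hfl⟩ := h
    refine .inl ⟨l, Finset.eq_singleton_iff_unique_mem.2 ⟨hl, fun y hy => ?_⟩⟩
    refine mem_of_induce_preconnected hS.preconnected (Q := fun y => y = .inr l)
      ?_ (Finset.mem_coe.2 hl) (Finset.mem_coe.2 hy) rfl
    rintro x hx (k | k) hy hadj rfl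
    · rw [caterpillar_adj_inr_inl] at hadj
      obtain rfl : k = ⟨f l, hf l⟩ := Fin.ext hadj.symm
      exact absurd hy hfl
    · simp at hadj
  · push Not at h
    right
    have hne : S.toLeft.Nonempty := by
      obtain ⟨⟨k | l, hx⟩⟩ := hS.nonempty
      · exact ⟨k, Finset.mem_toLeft.2 hx⟩
      · exact ⟨_, Finset.mem_toLeft.2 (h l hx)⟩
    have hicc : S.toLeft = Finset.Icc (S.toLeft.min' hne) (S.toLeft.max' hne) := by
      ext k
      refine ⟨fun hk => Finset.mem_Icc.2 ⟨Finset.min'_le _ _ hk, Finset.le_max' _ _ hk⟩,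
        fun hk => ?_⟩
      rw [Finset.mem_Icc] at hk
      by_contra hkS
      have hmin := Finset.min'_mem _ hne
      have hmax := Finset.max'_mem _ hne
      have hlt : S.toLeft.min' hne < k := lt_of_le_of_ne hk.1 fun e => hkS (e ▸ hmin)
      rw [Finset.mem_toLeft] at hmin hmax hkS
      -- Place each leaf at the position of its neighbour. With `k` missing, no edge inside `S`
      -- crosses from positions below `k` to the rest.
      refine absurd (mem_of_induce_preconnected hS.preconnected
        (Q := fun y => Sum.elim (fun i : Fin p => (i : ℕ)) f y < k) ?_ (Finset.mem_coe.2 hmin)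
        (Finset.mem_coe.2 hmax) hlt) (not_lt.2 hk.2)
      rintro (x | x) hx (y | y) hy hadj hxk
      · have : (y : ℕ) ≠ k := fun e => hkS (by rwa [← Fin.ext e])
        rw [caterpillar_adj_inl_inl] at hadj
        simp only [Sum.elim_inl] at hxk ⊢
        omega
      · rw [caterpillar_adj_inl_inr] at hadj
        simpa [hadj] using hxk
      · rw [caterpillar_adj_inr_inl] at hadj
        simpa [hadj] using hxk
      · simp at hadj
    refine ⟨_, _, Finset.min'_le_max' _ hne, S.toRight, fun l hl => ?_, ?_⟩
    · have := h l (Finset.mem_toRight.1 hl)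
      rw [← Finset.mem_toLeft, hicc, Finset.mem_Icc] at this
      exact Finset.mem_filter.2 ⟨Finset.mem_univ _, this⟩
    · rw [← hicc, Finset.toLeft_disjSum_toRight]

lemma sum_powerset_card_add (s : Finset L) (x : ℚ) :
    ∑ U ∈ s.powerset, (x + U.card) = 2 ^ s.card * (x + s.card / 2) := by
  classical
  rw [Finset.sum_add_distrib, Finset.sum_const, Finset.card_powerset, nsmul_eq_mul]
  have h : ∑ U ∈ s.powerset, (U.card : ℚ) = 2 ^ s.card * s.card / 2 := by
    -- Complementation in `s` shows that the average size of a subset is half of `s.card`.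
    have h1 : ∑ U ∈ s.powerset, (U.card : ℚ) = ∑ U ∈ s.powerset, ((s.card : ℚ) - U.card) := by
      refine Finset.sum_bij' (fun U _ => s \ U) (fun U _ => s \ U) ?_ ?_ ?_ ?_ ?_
      · simp
      · simp
      · intro U hU
        exact sdiff_sdiff_eq_self (Finset.mem_powerset.1 hU)
      · intro U hU
        exact sdiff_sdiff_eq_self (Finset.mem_powerset.1 hU)
      · intro U hU
        have := Finset.card_sdiff_add_card_eq_card (Finset.mem_powerset.1 hU)
        rw [← this]
        push_cast
        ring
    rw [Finset.sum_sub_distrib, Finset.sum_const, Finset.card_powerset, nsmul_eq_mul] at h1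
    push_cast at h1
    linarith
  rw [h]
  push_cast
  ring

/-- The contribution to the excess of the subtrees that meet the path in `i, …, j`. -/
def intervalExcess (c : ℕ → ℕ → ℕ) (t : ℚ) (i j : ℕ) : ℚ :=
  if i ≤ j then 2 ^ c i j * ((j : ℚ) - i + 1 + c i j / 2 - t) else 0

lemma excess_caterpillar (hf : ∀ l, f l < p) (t : ℚ) :
    excess (caterpillar p f) t = Fintype.card L * (1 - t) +
      ∑ i ∈ Finset.range p, ∑ j ∈ Finset.range p,
        intervalExcess (fun i j => (leavesBetween f i j).card) t i j := by
  classical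
  let P : Finset ((_ : Fin p × Fin p) × Finset L) :=
    (Finset.univ.filter fun q : Fin p × Fin p => q.1 ≤ q.2).sigma
      fun q => (leavesBetween f q.1 q.2).powerset
  have hsub : subtrees (caterpillar p f) =
      (Finset.univ.image fun l : L => ({.inr l} : Finset (Fin p ⊕ L))) ∪
        P.image fun q => (Finset.Icc q.1.1 q.1.2).disjSum q.2 := by
    ext S
    simp only [Finset.mem_union, Finset.mem_image, Finset.mem_univ, true_and]
    constructor
    · intro hS
      obtain ⟨l, rfl⟩ | ⟨i, j, hij, U, hU, rfl⟩ := eq_of_mem_subtrees hf hS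
      · exact .inl ⟨l, rfl⟩
      · exact .inr ⟨⟨(i, j), U⟩, by simp [P, hij, hU], rfl⟩
    · rintro (⟨l, rfl⟩ | ⟨⟨⟨i, j⟩, U⟩, hq, rfl⟩)
      · exact singleton_mem_subtrees _ _
      · simp only [P, Finset.mem_sigma, Finset.mem_filter, Finset.mem_univ, true_and,
          Finset.mem_powerset] at hq
        exact interval_mem_subtrees hq.1 hq.2
  have hdisj : Disjoint (Finset.univ.image fun l : L => ({.inr l} : Finset (Fin p ⊕ L)))
      (P.image fun q => (Finset.Icc q.1.1 q.1.2).disjSum q.2) := by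
    rw [Finset.disjoint_left]
    intro S h1 h2
    simp only [Finset.mem_image, Finset.mem_univ, true_and] at h1 h2
    obtain ⟨l, rfl⟩ := h1
    obtain ⟨⟨⟨i, j⟩, U⟩, hq, h⟩ := h2
    simp only [P, Finset.mem_sigma, Finset.mem_filter, Finset.mem_univ, true_and] at hq
    have : Sum.inl i ∈ ({.inr l} : Finset (Fin p ⊕ L)) := by
      rw [← h]
      simp [hq.1]
    simp at this
  rw [excess, hsub, Finset.sum_union hdisj, Finset.sum_image, Finset.sum_image]
  · congr 1
    · simp [mul_sub]
    · rw [Finset.sum_sigma, Finset.sum_filter, ← Finset.univ_product_univ, Finset.sum_product,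
        Finset.sum_range]
      refine Finset.sum_congr rfl fun i _ => ?_
      rw [Finset.sum_range]
      refine Finset.sum_congr rfl fun j _ => ?_
      simp only [intervalExcess, ← Fin.le_def]
      split_ifs with hij
      · rw [show ∀ x y z : ℚ, x + y / 2 - z = x - z + y / 2 by intros; ring, ← sum_powerset_card_add]
        refine Finset.sum_congr rfl fun U _ => ?_
        rw [Finset.card_disjSum, Fin.card_Icc]
        rw [Fin.le_def] at hij
        rw [Nat.cast_add, Nat.cast_sub (by omega)]
        push_cast
        ring
      · rfl
  · rintro ⟨⟨i, j⟩, U⟩ hq ⟨⟨i', j'⟩, U'⟩ hq' h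
    simp only [P, Finset.coe_sigma, Set.mem_sigma_iff, Finset.mem_coe, Finset.mem_filter,
      Finset.mem_univ, true_and] at hq hq'
    have hU := congrArg Finset.toRight h
    have hI := congrArg Finset.toLeft h
    simp only [Finset.toRight_disjSum, Finset.toLeft_disjSum] at hU hI
    have hI' : Set.Icc i j = Set.Icc i' j' := by
      rw [← Finset.coe_Icc, hI, Finset.coe_Icc]
    obtain ⟨rfl, rfl⟩ := (Set.Icc_eq_Icc_iff hq.1).1 hI'
    rw [hU]
  · intro l _ l' _ h
    simpa using h

lemma isTree_caterpillar (hp : 0 < p) (hf : ∀ l, f l < p) : (caterpillar p f).IsTree := by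
  classical
  have hcon : (caterpillar p f).Connected := by
    have : Finset.univ ∈ subtrees (caterpillar p f) := by
      have h := interval_mem_subtrees (f := f) (i := (⟨0, hp⟩ : Fin p))
        (j := ⟨p - 1, by omega⟩) (by simp [Fin.le_def]) (subset_refl _)
      convert h using 1
      ext x
      rcases x with x | x
      · have := x.2
        simp only [Finset.mem_univ, Finset.inl_mem_disjSum, Finset.mem_Icc, Fin.le_def, true_iff]
        omega
      · have := hf x
        simp only [Finset.mem_univ, Finset.inr_mem_disjSum, leavesBetween, Finset.mem_filter,
          true_and, true_iff]
        omega
    rw [mem_subtrees, Finset.coe_univ] at this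
    exact (SimpleGraph.induceUnivIso _).connected_iff.1 this
  rw [SimpleGraph.isTree_iff_connected_and_card]
  refine ⟨hcon, le_antisymm ?_ hcon.card_vert_le_card_edgeSet_add_one⟩
  -- Every edge joins a non-root vertex to its parent, which bounds the number of edges. Truncated
  -- subtraction makes the root its own parent, so it is erased.
  let par : Fin p ⊕ L → Fin p ⊕ L :=
    Sum.elim (fun i => .inl ⟨i - 1, by omega⟩) fun l => .inl ⟨f l, hf l⟩
  let r : Fin p ⊕ L := .inl ⟨0, hp⟩
  have hsub : (caterpillar p f).edgeSet ⊆
      ((Finset.univ.erase r).image fun v => s(v, par v) : Finset (Sym2 (Fin p ⊕ L))) := by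
    intro e
    induction e with
    | h x y =>
    simp only [SimpleGraph.mem_edgeSet, Finset.coe_image, Set.mem_image, Finset.mem_coe,
      Finset.mem_erase, Finset.mem_univ, and_true]
    rcases x with x | x <;> rcases y with y | y
    · rw [caterpillar_adj_inl_inl]
      rintro (h | h)
      · refine ⟨.inl y, by simp [r, Fin.ext_iff]; omega, ?_⟩
        rw [Sym2.eq_swap]
        congr
        simp only [par, Sum.elim_inl, Sum.inl.injEq, Fin.ext_iff]
        omega
      · refine ⟨.inl x, by simp [r, Fin.ext_iff]; omega, ?_⟩
        congr
        simp only [par, Sum.elim_inl, Sum.inl.injEq, Fin.ext_iff]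
        omega
    · rw [caterpillar_adj_inl_inr]
      intro h
      refine ⟨.inr y, by simp [r], ?_⟩
      rw [Sym2.eq_swap]
      simp [par, h]
    · rw [caterpillar_adj_inr_inl]
      intro h
      refine ⟨.inr x, by simp [r], ?_⟩
      simp [par, h]
    · simp
  have h1 := Nat.card_mono (Finset.finite_toSet _) hsub
  rw [Nat.card_coe_set_eq, Nat.card_coe_set_eq, Set.ncard_coe_finset] at h1
  rw [← Nat.card_coe_set_eq] at h1
  have h2 := h1.trans Finset.card_image_le
  rw [Finset.card_erase_of_mem (Finset.mem_univ _), Finset.card_univ, ← Nat.card_eq_fintype_card]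
    at h2
  have : 0 < Nat.card (Fin p ⊕ L) := by
    have : Nonempty (Fin p ⊕ L) := ⟨r⟩
    exact Nat.card_pos
  omega

end caterpillar

/-! ### Excess of brooms and of the modified broom -/

lemma card_leavesBetween_elim {L M : Type*} [Fintype L] [Fintype M] (f : L → ℕ) (g : M → ℕ)
    (i j : ℕ) : (leavesBetween (Sum.elim f g) i j).card =
      (leavesBetween f i j).card + (leavesBetween g i j).card := by
  simp only [leavesBetween, Finset.card_filter, Fintype.sum_sum_type, Sum.elim_inl, Sum.elim_inr]
  congr

lemma card_leavesBetween_const {L : Type*} [Fintype L] (k i j : ℕ) :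
    (leavesBetween (fun _ : L => k) i j).card = if i ≤ k ∧ k ≤ j then Fintype.card L else 0 := by
  unfold leavesBetween
  split_ifs with h <;> simp [h]

lemma doubleBroom_eq_caterpillar (p a b : ℕ) :
    doubleBroom p a b =
      caterpillar p (Sum.elim (fun _ : Fin a => 0) (fun _ : Fin b => p - 1)) := by
  ext x y
  rcases x with x | x | x <;> rcases y with y | y | y <;>
    simp [doubleBroom, caterpillar] <;> omega

/-- The number of leaves attached to the vertices `i, …, j` of the path of a double-broom. -/
def broomLeaves (p a b i j : ℕ) : ℕ :=
  (if i ≤ 0 ∧ 0 ≤ j then a else 0) + (if i ≤ p - 1 ∧ p - 1 ≤ j then b else 0)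

lemma excess_doubleBroom {p : ℕ} (hp : 0 < p) (a b : ℕ) (t : ℚ) :
    excess (doubleBroom p a b) t = (a + b) * (1 - t) +
      ∑ i ∈ Finset.range p, ∑ j ∈ Finset.range p, intervalExcess (broomLeaves p a b) t i j := by
  rw [doubleBroom_eq_caterpillar, excess_caterpillar]
  · simp only [card_leavesBetween_elim, card_leavesBetween_const, Fintype.card_sum,
      Fintype.card_fin, Nat.cast_add]
    rfl
  · rintro (l | l) <;> simp <;> omega

lemma isTree_doubleBroom {p : ℕ} (hp : 0 < p) (a b : ℕ) : (doubleBroom p a b).IsTree := by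
  rw [doubleBroom_eq_caterpillar]
  refine isTree_caterpillar hp ?_
  rintro (l | l) <;> simp <;> omega

/-- The tree obtained from `doubleBroom p (a + 1) b` by moving one leaf from the first vertex of
the path to the second one. -/
def movedBroom (p a b : ℕ) : SimpleGraph (Fin p ⊕ Fin 1 ⊕ Fin a ⊕ Fin b) :=
  caterpillar p (Sum.elim (fun _ => 1) (Sum.elim (fun _ => 0) (fun _ => p - 1)))

lemma isTree_movedBroom {p : ℕ} (hp : 2 ≤ p) (a b : ℕ) : (movedBroom p a b).IsTree := by
  refine isTree_caterpillar (by omega) ?_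
  rintro (l | l | l) <;> simp <;> omega

lemma excess_movedBroom {p : ℕ} (hp : 2 ≤ p) (a b : ℕ) (t : ℚ) :
    excess (movedBroom p a b) t = (a + 1 + b) * (1 - t) +
      ∑ i ∈ Finset.range p, ∑ j ∈ Finset.range p, intervalExcess
        (fun i j => (if i ≤ 1 ∧ 1 ≤ j then 1 else 0) + broomLeaves p a b i j) t i j := by
  rw [movedBroom, excess_caterpillar]
  · simp only [card_leavesBetween_elim, card_leavesBetween_const, broomLeaves, Fintype.card_sum,
      Fintype.card_fin]
    push_cast
    ring
  · rintro (l | l | l) <;> simp <;> omega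

/-! ### Estimates for the excess -/

lemma intervalExcess_nonpos {c : ℕ → ℕ → ℕ} {t : ℚ} {i j : ℕ}
    (h : (j : ℚ) - i + 1 + c i j / 2 ≤ t) : intervalExcess c t i j ≤ 0 := by
  unfold intervalExcess
  split_ifs
  · exact mul_nonpos_of_nonneg_of_nonpos (by positivity) (by linarith)
  · rfl

/-- Each interval's subtrees have average order at most `p + (a + b) / 2`; the single leaves make
the inequality strict. -/
lemma excess_doubleBroom_neg_of_lt {p a b : ℕ} (hp : 0 < p) (ha : 0 < a) {t : ℚ}
    (ht : (p : ℚ) + (a + b) / 2 < t) : excess (doubleBroom p a b) t < 0 := by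
  have hp' : (1 : ℚ) ≤ p := by exact_mod_cast hp
  have ha' : (1 : ℚ) ≤ a := by exact_mod_cast ha
  have hb' : (0 : ℚ) ≤ b := by positivity
  rw [excess_doubleBroom hp]
  refine add_neg_of_neg_of_nonpos (mul_neg_of_pos_of_neg (by linarith) (by linarith))
    (Finset.sum_nonpos fun i _ => Finset.sum_nonpos fun j hj => intervalExcess_nonpos ?_)
  have h1 : (broomLeaves p a b i j : ℚ) ≤ a + b := by
    have : broomLeaves p a b i j ≤ a + b := by
      unfold broomLeaves
      split_ifs <;> omega
    exact_mod_cast this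
  have h2 : (j : ℚ) + 1 ≤ p := by exact_mod_cast Finset.mem_range.1 hj
  have h3 : (0 : ℚ) ≤ i := by positivity
  linarith

lemma sum_range_add_const (q : ℕ) (x : ℚ) :
    ∑ j ∈ Finset.range q, ((j : ℚ) + x) = q * ((q - 1) / 2 + x) := by
  induction q with
  | zero => simp
  | succ q ih =>
    rw [Finset.sum_range_succ, ih]
    push_cast
    ring

lemma sum_range_sub_const (q : ℕ) (x : ℚ) :
    ∑ i ∈ Finset.range q, ((q : ℚ) - i + x) = q * ((q + 1) / 2 + x) := by
  have h := sum_range_add_const q 0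
  have e : ∀ i : ℕ, (q : ℚ) - i + x = (q + x) - (i + 0) := fun i => by ring
  simp only [e]
  rw [Finset.sum_sub_distrib, h]
  simp
  ring

lemma sum_range_ite_nonpos {k q : ℕ} {t : ℚ} (ht : ((q : ℚ) + 1) / 2 ≤ t) :
    ∑ j ∈ Finset.range q, (if k ≤ j then (j : ℚ) - k + 1 - t else 0) ≤ 0 := by
  rcases le_total q k with h | h
  · refine Finset.sum_nonpos fun j hj => ?_
    rw [if_neg (by have := Finset.mem_range.1 hj; omega)]
  · obtain ⟨d, rfl⟩ := Nat.exists_eq_add_of_le h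
    rw [Finset.sum_range_add, Finset.sum_eq_zero, zero_add]
    · have e : ∀ j : ℕ, (if k ≤ k + j then ((k + j : ℕ) : ℚ) - k + 1 - t else 0) =
          j + (1 - t) := fun j => by
        rw [if_pos (by omega)]
        push_cast
        ring
      simp only [e]
      rw [sum_range_add_const]
      push_cast at ht
      have : (0 : ℚ) ≤ k := by positivity
      exact mul_nonpos_of_nonneg_of_nonpos (by positivity) (by linarith)
    · intro j hj
      rw [if_neg (by have := Finset.mem_range.1 hj; omega)]

/-- Only intervals starting at vertex 0 are kept. The bound on `t` makes the rest nonpositive once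
summed along rows that avoid the far end, and over all intervals that reach it. -/
lemma excess_doubleBroom_le (q a b : ℕ) {t : ℚ} (ht : ((q : ℚ) + 1 + b) / 2 ≤ t) (ht1 : 1 ≤ t) :
    excess (doubleBroom (q + 1) a b) t ≤
      2 ^ a * (2 ^ b * (q + 1 + (a + b) / 2 - t) + q * ((q + 1 + a) / 2 - t)) := by
  have hb : (0 : ℚ) ≤ b := by positivity
  rw [excess_doubleBroom (by omega), Finset.sum_range_succ', Finset.sum_range_succ]
  have h1 : ∑ j ∈ Finset.range q, intervalExcess (broomLeaves (q + 1) a b) t 0 j =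
      2 ^ a * (q * ((q + 1 + a) / 2 - t)) := by
    have : ∀ j ∈ Finset.range q, intervalExcess (broomLeaves (q + 1) a b) t 0 j =
        2 ^ a * (j + (1 + a / 2 - t)) := fun j hj => by
      have := Finset.mem_range.1 hj
      simp only [intervalExcess, broomLeaves, zero_le, true_and, if_true, Nat.add_sub_cancel,
        if_neg (show ¬ q ≤ j by omega)]
      push_cast
      ring
    rw [Finset.sum_congr rfl this, ← Finset.mul_sum, sum_range_add_const]
    ring
  have h2 : intervalExcess (broomLeaves (q + 1) a b) t 0 q =
      2 ^ a * 2 ^ b * (q + 1 + (a + b) / 2 - t) := by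
    simp only [intervalExcess, broomLeaves, zero_le, true_and, if_true, Nat.add_sub_cancel, le_refl]
    push_cast
    ring
  have h3 : ∑ i ∈ Finset.range q, ∑ j ∈ Finset.range (q + 1),
      intervalExcess (broomLeaves (q + 1) a b) t (i + 1) j ≤ 0 := by
    simp only [Finset.sum_range_succ]
    rw [Finset.sum_add_distrib]
    refine add_nonpos (Finset.sum_nonpos fun i _ => ?_) ?_
    · refine le_trans (le_of_eq (Finset.sum_congr rfl fun j hj => ?_))
        (sum_range_ite_nonpos (k := i + 1) (q := q) (t := t) (by linarith))
      have := Finset.mem_range.1 hj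
      simp [intervalExcess, broomLeaves, show ¬ q ≤ j by omega]
    · have : ∀ i ∈ Finset.range q, intervalExcess (broomLeaves (q + 1) a b) t (i + 1) q =
          2 ^ b * (q - i + (b / 2 - t)) := fun i hi => by
        have := Finset.mem_range.1 hi
        simp only [intervalExcess, broomLeaves, Nat.add_sub_cancel,
          if_pos (show i + 1 ≤ q by omega), if_neg (show ¬ (i + 1 ≤ 0 ∧ 0 ≤ q) by omega),
          if_pos (show i + 1 ≤ q ∧ q ≤ q by omega)]
        push_cast
        ring
      rw [Finset.sum_congr rfl this, ← Finset.mul_sum, sum_range_sub_const]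
      exact mul_nonpos_of_nonneg_of_nonpos (by positivity)
        (mul_nonpos_of_nonneg_of_nonpos (by positivity) (by linarith))
  have h4 : ((a : ℚ) + b) * (1 - t) ≤ 0 :=
    mul_nonpos_of_nonneg_of_nonpos (by positivity) (by linarith)
  rw [h1, h2]
  linarith

/-- The main term comes from the whole path. Every other interval carries at most `m` leaves, hence
contributes at least `-(2 ^ m * t)`. -/
lemma le_excess_doubleBroom (q m : ℕ) {t : ℚ} (ht : 0 ≤ t) :
    4 ^ m * (q + 1 + m - t) - t * (2 * m + (q + 1) ^ 2 * 2 ^ m) ≤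
      excess (doubleBroom (q + 1) m m) t := by
  rw [excess_doubleBroom (by omega)]
  have key : ∑ i ∈ Finset.range (q + 1), ∑ j ∈ Finset.range (q + 1),
      (-(2 ^ m * t) + if i = 0 then if j = q then 4 ^ m * (q + 1 + m - t) else 0 else 0) ≤
      ∑ i ∈ Finset.range (q + 1), ∑ j ∈ Finset.range (q + 1),
        intervalExcess (broomLeaves (q + 1) m m) t i j := by
    refine Finset.sum_le_sum fun i _ => Finset.sum_le_sum fun j hj => ?_
    have h0 : 0 ≤ 2 ^ m * t := by positivity
    by_cases hij : i ≤ j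
    swap
    · have := Finset.mem_range.1 hj
      have h : ¬ (i = 0) := by omega
      simp [intervalExcess, hij, h, h0]
    by_cases hfull : i = 0 ∧ j = q
    · obtain ⟨rfl, rfl⟩ := hfull
      have : intervalExcess (broomLeaves (j + 1) m m) t 0 j = 4 ^ m * (j + 1 + m - t) := by
        simp only [intervalExcess, broomLeaves, zero_le, true_and, if_true, Nat.add_sub_cancel,
          le_refl]
        rw [show (4 : ℚ) = 2 * 2 by norm_num, mul_pow, pow_add]
        push_cast
        ring
      rw [this]
      simp [h0]
    · have hjq := Finset.mem_range.1 hj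
      have hc : broomLeaves (q + 1) m m i j ≤ m := by
        unfold broomLeaves
        split_ifs <;> omega
      have h1 : (if i = 0 then if j = q then (4 : ℚ) ^ m * (q + 1 + m - t) else 0 else 0) = 0 := by
        split_ifs <;> tauto
      rw [h1, intervalExcess, if_pos hij, add_zero]
      have h2 : (2 : ℚ) ^ broomLeaves (q + 1) m m i j ≤ 2 ^ m :=
        pow_le_pow_right₀ (by norm_num) hc
      have h3 : (i : ℚ) ≤ j := by exact_mod_cast hij
      have h4 : 0 ≤ (2 : ℚ) ^ broomLeaves (q + 1) m m i j *
          ((j : ℚ) - i + 1 + (broomLeaves (q + 1) m m i j : ℚ) / 2) :=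
        mul_nonneg (by positivity) (add_nonneg (by linarith) (by positivity))
      have h5 := mul_le_mul_of_nonneg_right h2 ht
      linarith
  have hsum : ∑ i ∈ Finset.range (q + 1), ∑ j ∈ Finset.range (q + 1),
      (-(2 ^ m * t) + if i = 0 then if j = q then 4 ^ m * (q + 1 + m - t) else 0 else 0) =
      4 ^ m * (q + 1 + m - t) - (q + 1) ^ 2 * (2 ^ m * t) := by
    have hrow : ∀ i : ℕ, ∑ j ∈ Finset.range (q + 1),
        (-(2 ^ m * t) + if i = 0 then if j = q then 4 ^ m * (q + 1 + m - t) else 0 else 0) =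
        -((q + 1) * (2 ^ m * t)) + if i = 0 then 4 ^ m * (q + 1 + m - t) else 0 := fun i => by
      rw [Finset.sum_add_distrib]
      split_ifs <;> simp
    simp only [hrow]
    rw [Finset.sum_add_distrib]
    simp
    ring
  rw [hsum] at key
  have hm : (0 : ℚ) ≤ m := by positivity
  linarith

/-- Intervals containing both or neither of the vertices 0 and 1 keep their number of leaves. The
interval `{0}` loses a leaf (first term); those starting at 1 gain one, the last term being the one
that reaches the far end. -/
lemma excess_movedBroom_sub (r a b : ℕ) (t : ℚ) :
    excess (movedBroom (r + 3) a b) t - excess (doubleBroom (r + 3) (a + 1) b) t =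
      2 ^ a * (t - 2 - a / 2) + (r + 1) * ((r + 4) / 2 - t) + 2 ^ b * (r + 3 + b / 2 - t) := by
  rw [excess_movedBroom (by omega), excess_doubleBroom (by omega)]
  set c' : ℕ → ℕ → ℕ :=
    fun i j => (if i ≤ 1 ∧ 1 ≤ j then 1 else 0) + broomLeaves (r + 3) a b i j with hc'
  set c := broomLeaves (r + 3) (a + 1) b with hc
  have hD : ∑ i ∈ Finset.range (r + 3), ∑ j ∈ Finset.range (r + 3),
      (intervalExcess c' t i j - intervalExcess c t i j) =
      2 ^ a * (t - 2 - a / 2) + (r + 1) * ((r + 4) / 2 - t) + 2 ^ b * (r + 3 + b / 2 - t) := by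
    have hrow0 : ∑ j ∈ Finset.range (r + 3), (intervalExcess c' t 0 j - intervalExcess c t 0 j) =
        2 ^ a * (t - 2 - a / 2) := by
      rw [Finset.sum_range_succ', Finset.sum_eq_zero, zero_add]
      · simp [intervalExcess, hc', hc, broomLeaves]
        ring
      · intro j _
        have : c' 0 (j + 1) = c 0 (j + 1) := by
          simp [hc', hc, broomLeaves]
          omega
        simp [intervalExcess, this]
    have hrow1 : ∑ j ∈ Finset.range (r + 3), (intervalExcess c' t 1 j - intervalExcess c t 1 j) =
        (r + 1) * ((r + 4) / 2 - t) + 2 ^ b * (r + 3 + b / 2 - t) := by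
      have h10 : intervalExcess c' t 1 0 - intervalExcess c t 1 0 = 0 := by
        simp [intervalExcess]
      have h1q : intervalExcess c' t 1 (r + 2) - intervalExcess c t 1 (r + 2) =
          2 ^ b * (r + 3 + b / 2 - t) := by
        simp [intervalExcess, hc', hc, broomLeaves]
        ring
      have h1 : ∀ j ∈ Finset.range (r + 1),
          intervalExcess c' t 1 (j + 1) - intervalExcess c t 1 (j + 1) = j + (2 - t) := by
        intro j hj
        have := Finset.mem_range.1 hj
        simp [intervalExcess, hc', hc, broomLeaves, show ¬ r + 1 ≤ j by omega]
        ring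
      rw [Finset.sum_range_succ, Finset.sum_range_succ', h10, h1q, Finset.sum_congr rfl h1,
        sum_range_add_const]
      push_cast
      ring
    rw [Finset.sum_range_succ', Finset.sum_range_succ', Finset.sum_eq_zero, zero_add, zero_add,
      hrow0, hrow1]
    · ring
    · intro i _
      refine Finset.sum_eq_zero fun j _ => ?_
      have : c' (i + 1 + 1) j = c (i + 1 + 1) j := by simp [hc', hc, broomLeaves]
      simp [intervalExcess, this]
  simp only [Finset.sum_sub_distrib] at hD
  rw [← hD]
  push_cast
  ring

/-- Reversing the path of a double-broom. -/
def doubleBroomRev (p a b : ℕ) : doubleBroom p a b ≃g doubleBroom p b a where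
  toEquiv := Equiv.sumCongr Fin.revPerm (Equiv.sumComm _ _)
  map_rel_iff' := by
    intro x y
    rcases x with x | x | x <;> rcases y with y | y | y <;>
      simp [doubleBroom, Fin.ext_iff] <;> omega

/-! ### Comparison with an optimal tree -/

lemma bound_lt_two_pow {m : ℕ} (hm : 32 ≤ m) : 80 * (40 * m + 39) ^ 2 < 2 ^ m := by
  induction m, hm using Nat.le_induction with
  | base => norm_num
  | succ m hm ih =>
    have h : (40 * (m + 1) + 39) ^ 2 ≤ 2 * (40 * m + 39) ^ 2 := by nlinarith
    rw [pow_succ 2 m]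
    omega

lemma IsOptimal.le_meanSubtreeOrder {V : Type*} [Fintype V] {T : SimpleGraph V}
    (hT : IsOptimal T) (hn : 1280 ≤ Fintype.card V) :
    19 / 20 * (Fintype.card V : ℚ) ≤ meanSubtreeOrder T := by
  have : Nonempty V := Fintype.card_pos_iff.1 (by omega)
  set n := Fintype.card V with hn_def
  obtain ⟨q, hq⟩ : ∃ q, n = q + 1 + (n / 40 + n / 40) := ⟨n - 1 - (n / 40 + n / 40), by omega⟩
  -- The spanning-path subtrees average `n - m ≥ 39n/40`. As `1280 = 40 * 32`, `m ≥ 32`, so their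
  -- number `4 ^ m` swamps the error of order `n ^ 3 * 2 ^ m`.
  set m := n / 40 with hm
  by_contra! hlt
  have h1 := hT.excess_nonpos (isTree_doubleBroom (p := q + 1) (by omega) m m)
    (by simpa [← hn_def] using by omega)
  have h2 := (excess_antitone (doubleBroom (q + 1) m m) hlt.le).trans h1
  have h3 := (le_excess_doubleBroom q m (t := 19 / 20 * (n : ℚ)) (by positivity)).trans h2
  have hpow : 80 * (n : ℚ) ^ 2 < 2 ^ m := by
    have h4 := bound_lt_two_pow (m := m) (by omega)
    have h5 : n ≤ 40 * m + 39 := by omega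
    have h6 : 80 * n ^ 2 < 2 ^ m := lt_of_le_of_lt (by gcongr) h4
    exact_mod_cast h6
  have hqn : (n : ℚ) = q + 1 + (m + m) := by exact_mod_cast hq
  have hmn : (m : ℚ) ≤ n / 40 := by
    have : 40 * m ≤ n := by omega
    have : (40 : ℚ) * m ≤ n := by exact_mod_cast this
    linarith
  have hn1 : (1 : ℚ) ≤ n := by exact_mod_cast (by omega : 1 ≤ n)
  have h4m : (4 : ℚ) ^ m = 2 ^ m * 2 ^ m := by rw [← mul_pow]; norm_num
  have hm0 : (0 : ℚ) ≤ m := by positivity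
  have hq0 : (0 : ℚ) ≤ q := by positivity
  have e1 : (4 : ℚ) ^ m * (n / 40) ≤ 4 ^ m * (q + 1 + m - 19 / 20 * n) :=
    mul_le_mul_of_nonneg_left (by linarith) (by positivity)
  have e2 : 2 * (m : ℚ) + (q + 1) ^ 2 * 2 ^ m ≤ n + n ^ 2 * 2 ^ m := by
    have : ((q : ℚ) + 1) ^ 2 ≤ n ^ 2 := by
      apply pow_le_pow_left₀ <;> linarith
    have := mul_le_mul_of_nonneg_right this (by positivity : (0 : ℚ) ≤ 2 ^ m)
    linarith
  have e3 : (n : ℚ) ≤ n ^ 2 * 2 ^ m := by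
    have : (1 : ℚ) ≤ 2 ^ m := one_le_pow₀ (by norm_num)
    nlinarith
  have e4 : 19 / 20 * (n : ℚ) * (2 * m + (q + 1) ^ 2 * 2 ^ m) ≤
      19 / 20 * n * (2 * (n ^ 2 * 2 ^ m)) :=
    mul_le_mul_of_nonneg_left (by linarith) (by positivity)
  have e5 : (80 * (n : ℚ) ^ 2) * (2 ^ m * n) < 2 ^ m * (2 ^ m * n) :=
    mul_lt_mul_of_pos_right hpow (by positivity)
  have e6 : (0 : ℚ) < n * (n ^ 2 * 2 ^ m) := by positivity
  rw [h4m] at e1 h3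
  nlinarith

lemma not_isOptimal_of_iso_doubleBroom {n p a b : ℕ} (hn : 1280 ≤ n) (hp : 0 < p) (hb : 1 ≤ b)
    (hba : b ≤ a) {T : SimpleGraph (Fin n)} (e : T ≃g doubleBroom p a b) : ¬ IsOptimal T := by
  intro hT
  have : Nonempty (Fin n) := ⟨⟨0, by omega⟩⟩
  have hcard : n = p + (a + b) := by simpa using Fintype.card_congr e.toEquiv
  have hlow := hT.le_meanSubtreeOrder (by simpa using hn)
  have hzero := excess_meanSubtreeOrder T
  rw [excess_congr e] at hzero
  set t := meanSubtreeOrder T with ht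
  rw [Fintype.card_fin] at hlow
  have hcard' : (n : ℚ) = p + (a + b) := by exact_mod_cast hcard
  have hn' : (1280 : ℚ) ≤ n := by exact_mod_cast hn
  have hupp : t ≤ p + (a + b) / 2 := by
    by_contra! h
    exact (excess_doubleBroom_neg_of_lt hp (by omega) h).ne hzero
  have hab : (a : ℚ) + b ≤ n / 10 := by linarith
  have ha0 : (0 : ℚ) ≤ a := by positivity
  have hb0 : (0 : ℚ) ≤ b := by positivity
  have hp3 : 3 ≤ p := by
    have : (3 : ℚ) ≤ p := by linarith
    exact_mod_cast this
  obtain ⟨r, rfl⟩ := Nat.exists_eq_add_of_le' hp3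
  obtain ⟨a, rfl⟩ := Nat.exists_eq_add_of_le' (hb.trans hba)
  push_cast at *
  have hB : 2 * ((r : ℚ) + 3) ≤ 2 ^ b := by
    by_contra! hB
    have h := excess_doubleBroom_le (r + 2) (a + 1) b (t := t) (by push_cast; linarith)
      (by linarith)
    rw [hzero] at h
    refine absurd h (not_le.2 (mul_neg_of_pos_of_neg (by positivity) ?_))
    push_cast
    -- The whole-path term is at most `p * n / 10`, while intervals from vertex 0 missing the far
    -- end give at most `-(p - 1) * 9 * n / 20`.
    have h1 : (2 : ℚ) ^ b * (r + 2 + 1 + (a + 1 + b) / 2 - t) ≤ 2 * (r + 3) * (n / 20) :=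
      mul_le_mul hB.le (by linarith) (by linarith) (by positivity)
    have h2 : ((r : ℚ) + 2) * ((r + 2 + 1 + (a + 1)) / 2 - t) ≤ (r + 2) * (-(9 / 20) * n) :=
      mul_le_mul_of_nonneg_left (by linarith) (by positivity)
    nlinarith
  have hA : (2 : ℚ) ^ b ≤ 2 * 2 ^ a := by
    rw [← pow_succ']
    exact pow_le_pow_right₀ (by norm_num) hba
  have hmoved := hT.excess_nonpos (isTree_movedBroom (p := r + 3) (by omega) a b)
    (by simp only [Fintype.card_sum, Fintype.card_fin]; omega)
  have hsub := excess_movedBroom_sub r a b t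
  rw [hzero] at hsub
  -- `a` is now one less than the number of leaves at the first end. By `hupp`, the loss at the far
  -- end is at most `2 ^ a * (a + 1)`, leaving `2 ^ a * (t - 3 - 3 * a / 2)` of the gain; `hA` and
  -- `hB` give `2 ^ a ≥ r + 3`, enough to beat the remaining term.
  have h1 : (2 : ℚ) ^ b * (t - (r + 3 + b / 2)) ≤ 2 * 2 ^ a * ((a + 1) / 2) :=
    (mul_le_mul_of_nonneg_left (by linarith) (by positivity)).trans
      (mul_le_mul_of_nonneg_right hA (by positivity))
  have h2 : ((r : ℚ) + 3) * (t - 3 - 3 * a / 2) ≤ 2 ^ a * (t - 3 - 3 * a / 2) :=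
    mul_le_mul_of_nonneg_right (by linarith) (by linarith)
  nlinarith

end MeanSubtree

theorem mainTheorem9 :
    ∃ N : ℕ, ∀ n : ℕ, N ≤ n → ∀ T : SimpleGraph (Fin n),
      MeanSubtree.IsDoubleBroom T → ¬ MeanSubtree.IsOptimal T := by
  refine ⟨1280, fun n hn T ⟨p, a, b, hp, ha, hb, ⟨e⟩⟩ => ?_⟩
  rcases le_total b a with h | h
  · exact MeanSubtree.not_isOptimal_of_iso_doubleBroom hn hp hb h e
  · exact MeanSubtree.not_isOptimal_of_iso_doubleBroom hn hp ha h
      (e.trans (MeanSubtree.doubleBroomRev p a b))
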